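/- **Model.** Let $W_1:\mathcal X\to\mathcal Z$ and $W_2:\mathcal Y\to\mathcal Z$ be discrete memoryless channels (DMCs) with finite alphabets, $W_1$ from Alice to Bob and $W_2$ from an attacker Oscar to Bob; Alice and Bob also have a two-way noiseless channel controlled by Oscar. Let $\mathcal S$ be a finite source space. In an $L$-round authentication protocol there are $L$ flows, sent alternately by Alice and Bob (either may start). In her $i$-th flow Alice sends a word of a prescribed length $n_i\ge 0$ over $W_1$ and a message over the noiseless channel; in his flows Bob sends a message over the noiseless channel. Each next action is a function of the party's basic input (a source state $s\in\mathcal S$ for Alice, nothing for Bob), the party's random input (a uniformly random binary string) and the list of messages received so far (for Bob, these include the outputs of $W_1$). A party may also reject, which aborts the execution with Bob's output $\perp$. After the last flow Bob outputs an element of $\mathcal S\cup\{\perp\}$. The number of uses of $W_1$ is $n=\sum_i n_i$. *Type I attack:* during an execution between Alice with source state $s$ and Bob, Oscar sees the inputs and outputs of $W_1$ and all noiseless messages, and may replace each noiseless message by any other; he succeeds if Bob outputs $s'\notin\{s,\perp\}$. *Type II attack:* Oscar plays Alice's part with Bob, with $W_1$ replaced by $W_2$; he succeeds if Bob's output is not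 $\perp$. The protocol is *$\varepsilon$-secure with correctness error $\delta$* if (i) for every $s$ and every fixed random input of Alice, without attack, Bob outputs something other than $s$ with probability at most $\delta$, and (ii) every type I attack (for every $s$) and every type II attack succeeds with probability at most $\varepsilon$. Simply *$\varepsilon$-secure* is the case $\delta=\varepsilon$. Let $\log$ be the logarithm to base $2$ and let $\log^* x$ be the least $i\ge 0$ such that the $i$-fold iterate satisfies $\log^{(i)}x<2$ (with $\log^*0=0$). **Theorem.** Let $W_1,W_2$ be as above and let $\delta,\varepsilon$ be real numbers with $\delta+\varepsilon<1$. Then there is $n_0$, depending only on $W_1,W_2,\delta,\varepsilon$, such that for all $n\ge n_0$, all $L$ and all finite $\mathcal S$, every $L$-round authentication protocol for $\mathcal S$ with $n$ uses of $W_1$ that is $\varepsilon$-secure with correctness error $\delta$ satisfies $$L\ \ge\ \log^*|\mathcal S|-\log^* n-5 .$$ In particular this holds for $\varepsilon$-secure protocols for every fixed $\varepsilon<1/2$. -/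

import Mathlib

/-- `logStar x` is the least `i` such that the `i`-fold iterate of the base-2 logarithm
satisfies `log^(i) x < 2`. -/
noncomputable def logStar (x : ℝ) : ℕ := sInf {i : ℕ | (Real.logb 2)^[i] x < 2}

/-- The set in the definition of `logStar` is never empty, so the minimum exists. -/
theorem logStar_set_nonempty (x : ℝ) : {i : ℕ | (Real.logb 2)^[i] x < 2}.Nonempty := by
  have key : ∀ k : ℕ, ∀ y : ℝ, y < k + 2 → ∃ i : ℕ, (Real.logb 2)^[i] y < 2 := by
    intro k
    induction k with
    | zero => intro y hy; exact ⟨0, by simpa using hy⟩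
    | succ k ih =>
      intro y hy
      by_cases h2 : y < 2
      · exact ⟨0, by simpa using h2⟩
      · push Not at h2
        have hlog : Real.logb 2 y ≤ y - 1 := by
          rw [Real.logb_le_iff_le_rpow (by norm_num) (by linarith)]
          have h := one_add_mul_self_le_rpow_one_add (s := 1) (by norm_num) (p := y - 1)
            (by linarith)
          norm_num at h
          linarith
        obtain ⟨i, hi⟩ := ih (Real.logb 2 y) (by push_cast at hy; linarith)
        exact ⟨i + 1, by simpa [Function.iterate_succ_apply] using hi⟩
  obtain ⟨k, hk⟩ := exists_nat_gt x
  obtain ⟨i, hi⟩ := key k x (by linarith)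
  exact ⟨i, hi⟩

/-- `k` uses of the discrete memoryless channel with transition matrix `W` (the row of the input
letter `x` is the distribution `W x`): on input `x` the output word `z` has probability
`∏ i, W (z i | x i)`. -/
noncomputable def dmc {X Z : Type*} [Fintype Z] (W : X → PMF Z) {k : ℕ} (x : Fin k → X) :
    PMF (Fin k → Z) :=
  PMF.ofFintype (fun z => ∏ i, W (x i) (z i)) (by
    have h := (Finset.prod_univ_sum (fun _ : Fin k => (Finset.univ : Finset Z))
      (fun i z => W (x i) z)).symm
    rw [Fintype.piFinset_univ] at h
    rw [h]
    refine Finset.prod_eq_one fun i _ => ?_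
    rw [← tsum_fintype (L := .unconditional _)]
    exact (W (x i)).tsum_coe)

/-- The probability of an event, as a real number. -/
noncomputable def PMF.prob {α : Type*} (p : PMF α) (A : Set α) : ℝ := (p.toOuterMeasure A).toReal

/-- An `L`-round authentication protocol: source space `S`, input alphabet `X` and output alphabet
`Z` of the noisy channel from Alice to Bob, `M` the messages on the noiseless channel.
The rounds (flows) `0, …, L-1` are sent alternately by Alice and Bob.

* In an Alice flow `j` she sends a word of length `uses j` over the noisy channel and an element of
  `M` over the noiseless channel; in a Bob flow he sends an element of `M` noiselessly.
* Next actions are functions of the party's basic input (`s` for Alice, nothing for Bob), random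
  input (a binary string) and the list of messages received so far; Bob receives pairs of a noisy
  channel output word and a noiseless message.
* The value `none` of `alice` and `bob` means that the party rejects and aborts.
* After the last flow, Bob outputs a source state, or `none`, which stands for `⊥`. -/
structure AuthProtocol (X Z S M : Type*) (L : ℕ) where
  aliceFirst : Bool
  uses : ℕ → ℕ
  tapeA : ℕ
  tapeB : ℕ
  alice : (j : ℕ) → S → (Fin tapeA → Bool) → List M → Option ((Fin (uses j) → X) × M)
  bob : (j : ℕ) → (Fin tapeB → Bool) → List (List Z × M) → Option M
  output : (Fin tapeB → Bool) → List (List Z × M) → Option S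

/-- What Oscar sees and does in one flow of a type I attack: in an Alice flow the input `x` and the
output `z` of the noisy channel, the noiseless message `u` and the message `u'` that he delivers in
its place; in a Bob flow the message `v` and the message `v'` that he delivers in its place. -/
inductive OscarEvent (X Z M : Type*) where
  | aliceFlow (x : List X) (z : List Z) (u u' : M)
  | bobFlow (v v' : M)

/-- A (computationally unbounded, possibly randomized) type I strategy of Oscar: given the past
flows and what is sent in the current flow, the distribution of the noiseless message that he
delivers. -/
structure TypeIAttack (X Z M : Type*) where
  toBob : List (OscarEvent X Z M) → List X → List Z → M → PMF M
  toAlice : List (OscarEvent X Z M) → M → PMF M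

/-- No attack: all noiseless messages are delivered unchanged. -/
noncomputable def TypeIAttack.passive (X Z M : Type*) : TypeIAttack X Z M where
  toBob _ _ _ u := PMF.pure u
  toAlice _ v := PMF.pure v

/-- A type II strategy of Oscar, who plays Alice's part towards Bob: in each Alice flow `j`, given
his own past inputs and messages (`Sum.inl`) and Bob's messages (`Sum.inr`), the distribution of
the word that he inputs to his noisy channel and of his noiseless message. -/
structure TypeIIAttack (Y M : Type*) (uses : ℕ → ℕ) where
  send : (j : ℕ) → List ((List Y × M) ⊕ M) → PMF ((Fin (uses j) → Y) × M)

namespace AuthProtocol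

variable {X Y Z S M : Type*} {L : ℕ}

/-- Whether flow `j` is sent by Alice. -/
def aliceSends (P : AuthProtocol X Z S M L) (j : ℕ) : Bool := decide (Even j) == P.aliceFirst

/-- The total number `n` of uses of the noisy channel from Alice to Bob. -/
def numUses (P : AuthProtocol X Z S M L) : ℕ :=
  ∑ j ∈ Finset.range L, if P.aliceSends j then P.uses j else 0

variable [Fintype Z]

/-- Bob's output in an execution between Alice (source state `s`, random input `rA`) and Bob
(random input `rB`) with the type I attacker `O`, over the noisy channel `W₁`. The first numerical
argument is the number of remaining flows, the second one the index of the current flow, then come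
the lists of what Alice, Bob and Oscar have received or seen so far. If a party aborts, the
execution ends and Bob does not accept. -/
noncomputable def runI (P : AuthProtocol X Z S M L) (W₁ : X → PMF Z) (O : TypeIAttack X Z M)
    (s : S) (rA : Fin P.tapeA → Bool) (rB : Fin P.tapeB → Bool) :
    ℕ → ℕ → List M → List (List Z × M) → List (OscarEvent X Z M) → PMF (Option S)
  | 0, _, _, viewB, _ => PMF.pure (P.output rB viewB)
  | k + 1, j, viewA, viewB, viewO =>
    if P.aliceSends j then
      match P.alice j s rA viewA with
      | none => PMF.pure none
      | some (x, u) =>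
        (dmc W₁ x).bind fun z =>
        (O.toBob viewO (List.ofFn x) (List.ofFn z) u).bind fun u' =>
        P.runI W₁ O s rA rB k (j + 1) viewA (viewB ++ [(List.ofFn z, u')])
          (viewO ++ [.aliceFlow (List.ofFn x) (List.ofFn z) u u'])
    else
      match P.bob j rB viewB with
      | none => PMF.pure none
      | some v =>
        (O.toAlice viewO v).bind fun v' =>
        P.runI W₁ O s rA rB k (j + 1) (viewA ++ [v']) viewB (viewO ++ [.bobFlow v v'])

/-- Bob's output in an execution between the type II attacker `O`, who uses the noisy channel `W₂`,
and Bob (random input `rB`). -/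
noncomputable def runII (P : AuthProtocol X Z S M L) (W₂ : Y → PMF Z)
    (O : TypeIIAttack Y M P.uses) (rB : Fin P.tapeB → Bool) :
    ℕ → ℕ → List (List Z × M) → List ((List Y × M) ⊕ M) → PMF (Option S)
  | 0, _, viewB, _ => PMF.pure (P.output rB viewB)
  | k + 1, j, viewB, viewO =>
    if P.aliceSends j then
      (O.send j viewO).bind fun yu =>
      (dmc W₂ yu.1).bind fun z =>
      P.runII W₂ O rB k (j + 1) (viewB ++ [(List.ofFn z, yu.2)])
        (viewO ++ [Sum.inl (List.ofFn yu.1, yu.2)])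
    else
      match P.bob j rB viewB with
      | none => PMF.pure none
      | some v => P.runII W₂ O rB k (j + 1) viewB (viewO ++ [Sum.inr v])

/-- Execution without attack of an admissible Alice, who uses the fixed random input `rA`, with Bob,
whose random input is uniform. -/
noncomputable def honest (P : AuthProtocol X Z S M L) (W₁ : X → PMF Z) (s : S)
    (rA : Fin P.tapeA → Bool) : PMF (Option S) :=
  (PMF.uniformOfFintype (Fin P.tapeB → Bool)).bind fun rB =>
    P.runI W₁ (TypeIAttack.passive X Z M) s rA rB L 0 [] [] []

/-- Type I attack by `O` on Alice with source state `s`; both random inputs are uniform. -/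
noncomputable def attackI (P : AuthProtocol X Z S M L) (W₁ : X → PMF Z) (O : TypeIAttack X Z M)
    (s : S) : PMF (Option S) :=
  (PMF.uniformOfFintype (Fin P.tapeA → Bool)).bind fun rA =>
  (PMF.uniformOfFintype (Fin P.tapeB → Bool)).bind fun rB =>
    P.runI W₁ O s rA rB L 0 [] [] []

/-- Type II attack by `O`; Bob's random input is uniform. -/
noncomputable def attackII (P : AuthProtocol X Z S M L) (W₂ : Y → PMF Z)
    (O : TypeIIAttack Y M P.uses) : PMF (Option S) :=
  (PMF.uniformOfFintype (Fin P.tapeB → Bool)).bind fun rB => P.runII W₂ O rB L 0 [] []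

/-- `ε`-security with correctness error `δ`. Correctness: for every admissible Alice, Bob outputs
something else than her source state with probability at most `δ` if there is no attack.
Authentication: a type I attack makes Bob accept a source state different from Alice's with
probability at most `ε`, and a type II attack makes Bob accept with probability at most `ε`. -/
structure IsSecure (P : AuthProtocol X Z S M L) (W₁ : X → PMF Z) (W₂ : Y → PMF Z)
    (δ ε : ℝ) : Prop where
  correctness : ∀ (s : S) (rA : Fin P.tapeA → Bool), (P.honest W₁ s rA).prob {o | o ≠ some s} ≤ δ
  typeI : ∀ (O : TypeIAttack X Z M) (s : S),
    (P.attackI W₁ O s).prob {o | o ≠ some s ∧ o ≠ none} ≤ ε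
  typeII : ∀ O : TypeIIAttack Y M P.uses, (P.attackII W₂ O).prob {o | o ≠ none} ≤ ε

end AuthProtocol

/-!
The bound follows from the correctness of the protocol and its security against a single type I
attack, in which Oscar lets Alice with source state `s` pass for an Alice with source state `s'`. He
runs a simulated Alice with source state `s'` towards Bob. Since he cannot tamper with the noisy
channel, the words that Alice sends over it have to be those that the simulated Alice would send;
apart from that he is free to choose what is delivered noiselessly to either side.

To know when this is possible, attach a `Profile` to each situation of Alice, by recursion on the
number of flows to go. In a situation, she has received certain messages and her random input is
uniform on the set of tapes compatible with what she has sent.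

* Before a flow of Alice, the profile records the joint distribution of the word that she sends and
  of her next profile, rounded to a grid.
* Before a flow of Bob, it records which next profiles his messages can lead to.

If Alice and the simulated Alice have the same profile, Oscar can keep it so. In a flow of Alice, he
draws the random input of the simulated Alice conditionally on her sending the same word and
reaching the same next profile as Alice (`expect_matching_le`); in a flow of Bob, he delivers to
Alice a message that leads to the profile that Bob's message leads the simulated Alice to
(`exists_profile_append_eq`). But for the rounding, the simulated Alice then behaves towards Bob
like a genuine Alice with source state `s'` and a uniformly random tape, because the conditional
draws add up to a uniform one (`expect_le_expect_of_labels`); so Bob outputs `s'` with probability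
at least `1 - δ` minus a rounding error (`expect_passive_le_expect_impersonate`). The precision of the
grid increases geometrically with the number of flows to go, so that the total error is at most
`1 / D`, whatever the number of rounds. When `1 / D < 1 - δ - ε`, security implies that all source
states have different initial profiles (`card_le_profileCount`).

It remains to count. The number of profiles for `k + 1` flows is `2` to a power that is polynomial
in the number for `k` flows, in `D * 2 ^ k` and in `(card X + 1) ^ n`. Hence each flow costs one
exponential, up to terms that can be absorbed at the bottom of the tower
(`profileCount_sq_le`), and the bottom is at most `2 ^ 2 ^ n` for large `n`.
-/

/-! ### Iterated logarithms -/

theorem logStar_le_of_iterate_lt {x : ℝ} {i : ℕ} (h : (Real.logb 2)^[i] x < 2) : logStar x ≤ i :=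
  Nat.sInf_le h

theorem logStar_of_lt {x : ℝ} (h : x < 2) : logStar x = 0 :=
  Nat.le_zero.1 (logStar_le_of_iterate_lt (i := 0) h)

theorem logStar_le_logStar_logb_add_one (x : ℝ) : logStar x ≤ logStar (Real.logb 2 x) + 1 :=
  logStar_le_of_iterate_lt (by
    rw [Function.iterate_succ_apply]
    exact Nat.sInf_mem (logStar_set_nonempty (Real.logb 2 x)))

theorem logStar_logb_add_one_le {x : ℝ} (hx : 2 ≤ x) :
    logStar (Real.logb 2 x) + 1 ≤ logStar x := by
  have h : (Real.logb 2)^[logStar x] x < 2 := Nat.sInf_mem (logStar_set_nonempty x)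
  rcases hi : logStar x with _ | i
  · rw [hi] at h
    exact absurd h (not_lt.2 hx)
  · rw [hi, Function.iterate_succ_apply] at h
    exact Nat.succ_le_succ (logStar_le_of_iterate_lt h)

theorem logStar_mono {x y : ℝ} (hxy : x ≤ y) : logStar x ≤ logStar y := by
  induction hi : logStar y generalizing x y with
  | zero =>
    have h : (Real.logb 2)^[logStar y] y < 2 := Nat.sInf_mem (logStar_set_nonempty y)
    rw [hi] at h
    exact (logStar_of_lt (lt_of_le_of_lt hxy h)).le
  | succ i ih =>
    rcases lt_or_ge x 2 with hx | hx
    · simp [logStar_of_lt hx]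
    · refine (logStar_le_logStar_logb_add_one x).trans (Nat.succ_le_succ ?_)
      have h1 := logStar_logb_add_one_le (hx.trans hxy)
      have h2 := logStar_le_logStar_logb_add_one y
      exact ih (Real.logb_le_logb_of_le (by norm_num) (by linarith) hxy) (by omega)

theorem logStar_two_pow_le (m : ℕ) : logStar ((2 ^ m : ℕ) : ℝ) ≤ logStar (m : ℝ) + 1 := by
  refine (logStar_le_logStar_logb_add_one _).trans (le_of_eq ?_)
  rw [Nat.cast_pow, Nat.cast_ofNat, Real.logb_pow, Real.logb_self_eq_one (by norm_num), mul_one]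

theorem logStar_iterate_two_pow_le (m k : ℕ) :
    logStar (((fun i => 2 ^ i)^[k] m : ℕ) : ℝ) ≤ logStar (m : ℝ) + k := by
  induction k with
  | zero => simp
  | succ k ih =>
    rw [Function.iterate_succ_apply']
    exact (logStar_two_pow_le _).trans (by omega)

/-! ### The number of profiles -/

/-- The number of profiles of an Alice with `k` flows to go, when there are `w` codes of words and
the precision of the rounding is governed by `D`; see `profileGrid` for the grid used at depth
`k`. -/
def profileCount (w D : ℕ) : ℕ → ℕ
  | 0 => 1
  | k + 1 => (D * 2 ^ (k + 1) * (w * profileCount w D k) + 1) ^ (w * profileCount w D k)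

/-- The denominator of the grid to which the transition probabilities of an Alice with `k + 1`
flows to go are rounded. It exceeds the number of possible transitions by a factor
`D * 2 ^ (k + 1)`, so that the errors made in all the flows sum up to at most `1 / D`. -/
def profileGrid (w D k : ℕ) : ℕ := D * 2 ^ (k + 1) * (w * profileCount w D k)

theorem profileCount_pos (w D k : ℕ) : 0 < profileCount w D k := by
  cases k with
  | zero => exact Nat.one_pos
  | succ k => exact Nat.pow_pos (Nat.succ_pos _)

/-- The quantity on the left bounds the exponent of `2` in the next count; the factor `4` and the
summand `3` make the bound inductive. -/
theorem profileCount_sq_le {w D : ℕ} (hw : 0 < w) (hD : 0 < D) (k : ℕ) :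
    4 * ((w * D) ^ 2 * 2 ^ (k + 1) * profileCount w D k ^ 2) + 3 ≤
      (fun i => 2 ^ i)^[k] (8 * (w * D) ^ 2 + 3) := by
  induction k with
  | zero => simp [profileCount]; omega
  | succ k ih =>
    rw [Function.iterate_succ_apply']
    refine le_trans ?_ (Nat.pow_le_pow_right (by norm_num) ih)
    set y := (w * D) ^ 2 * 2 ^ (k + 1) * profileCount w D k ^ 2 with hy
    have hN := profileCount_pos w D k
    have hy0 : 0 < y := by positivity
    have h1 : profileCount w D (k + 1) ≤ 2 ^ y := by
      rw [profileCount]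
      set N := profileCount w D k
      have h2 : D * 2 ^ (k + 1) * (w * N) + 1 ≤ 2 ^ (D * 2 ^ (k + 1) * (w * N)) :=
        Nat.lt_two_pow_self
      refine (Nat.pow_le_pow_left h2 _).trans ?_
      rw [← pow_mul]
      refine Nat.pow_le_pow_right (by norm_num) ?_
      have h3 : D * 2 ^ (k + 1) * (w * N) * (w * N) * 1 ≤ D * 2 ^ (k + 1) * (w * N) * (w * N) * D :=
        Nat.mul_le_mul_left _ hD
      calc _ = D * 2 ^ (k + 1) * (w * N) * (w * N) * 1 := by ring
        _ ≤ _ := h3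
        _ = _ := by rw [hy]; ring
    have h4 : (w * D) ^ 2 * 2 ^ (k + 1) ≤ y := Nat.le_mul_of_pos_right _ (by positivity)
    have h5 : y ≤ 2 ^ y := Nat.lt_two_pow_self.le
    have h6 : (w * D) ^ 2 * 2 ^ (k + 1 + 1) * profileCount w D (k + 1) ^ 2 ≤
        2 * 2 ^ y * (2 ^ y) ^ 2 := by
      rw [pow_succ 2 (k + 1), ← mul_assoc]
      refine Nat.mul_le_mul ?_ (Nat.pow_le_pow_left h1 2)
      omega
    have h7 : 2 ^ (4 * y + 3) = 8 * (2 ^ y) ^ 4 := by rw [pow_add, mul_comm 4 y, pow_mul]; ring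
    have h8 : 2 ≤ 2 ^ y := Nat.le_self_pow hy0.ne' 2
    have h9 : (2 ^ y) ^ 3 * 2 ≤ (2 ^ y) ^ 4 := by rw [pow_succ _ 3]; exact Nat.mul_le_mul_left _ h8
    have h10 : 1 ≤ (2 ^ y) ^ 3 := Nat.one_le_iff_ne_zero.2 (by positivity)
    have h11 : 2 * 2 ^ y * (2 ^ y) ^ 2 = 2 * (2 ^ y) ^ 3 := by ring
    rw [h7]
    omega

/-- A bound for the bottom of the tower in `profileCount_sq_le`, with `b ^ n` codes of words. -/
theorem eight_mul_sq_add_three_le {b D n : ℕ} (hn : 2 * b + 2 * D + 4 ≤ n) :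
    8 * (b ^ n * D) ^ 2 + 3 ≤ 2 ^ 2 ^ n := by
  have h1 : b ^ n * D ≤ 2 ^ (b * n + D) := by
    rw [pow_add, pow_mul]
    exact Nat.mul_le_mul (Nat.pow_le_pow_left Nat.lt_two_pow_self.le n) Nat.lt_two_pow_self.le
  have h2 : n ^ 2 ≤ 2 ^ n := by
    have : ∀ m : ℕ, (m + 4) ^ 2 ≤ 2 ^ (m + 4) := by
      intro m
      induction m with
      | zero => norm_num
      | succ m ih => 
        have : (m + 1 + 4) ^ 2 ≤ (m + 4) ^ 2 * 2 := by ring_nf; omega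
        rw [show m + 1 + 4 = m + 4 + 1 by ring, pow_succ 2 (m + 4)] at *
        omega
    obtain ⟨m, rfl⟩ := Nat.exists_eq_add_of_le' (show 4 ≤ n by omega)
    exact this m
  have h3 : 2 * (b * n + D) + 4 ≤ n ^ 2 := by nlinarith
  have h4 : 2 ^ (2 * (b * n + D) + 4) ≤ 2 ^ 2 ^ n := Nat.pow_le_pow_right (by norm_num) (h3.trans h2)
  have h5 : 2 ^ (2 * (b * n + D) + 4) = 16 * (2 ^ (b * n + D)) ^ 2 := by
    rw [pow_add, mul_comm 2, pow_mul]; ring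
  have h6 : (b ^ n * D) ^ 2 ≤ (2 ^ (b * n + D)) ^ 2 := Nat.pow_le_pow_left h1 2
  have h7 : 1 ≤ (2 ^ (b * n + D)) ^ 2 := Nat.one_le_iff_ne_zero.2 (by positivity)
  omega

theorem logStar_profileCount_le {b D n : ℕ} (hb : 0 < b) (hD : 0 < D)
    (hn : 2 * b + 2 * D + 4 ≤ n) (L : ℕ) :
    logStar (profileCount (b ^ n) D L : ℝ) ≤ logStar (n : ℝ) + 2 + L := by
  have hw : 0 < b ^ n := Nat.pow_pos hb
  have h1 : profileCount (b ^ n) D L ≤ (fun i => 2 ^ i)^[L] (8 * (b ^ n * D) ^ 2 + 3) := by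
    refine le_trans ?_ (profileCount_sq_le hw hD L)
    have h2 : profileCount (b ^ n) D L ≤ profileCount (b ^ n) D L ^ 2 :=
      Nat.le_self_pow two_ne_zero _
    have h3 : 1 * profileCount (b ^ n) D L ^ 2 ≤
        (b ^ n * D) ^ 2 * 2 ^ (L + 1) * profileCount (b ^ n) D L ^ 2 :=
      Nat.mul_le_mul_right _ (Nat.one_le_iff_ne_zero.2 (by positivity))
    omega
  calc _ ≤ _ := logStar_mono (Nat.cast_le.2 h1)
    _ ≤ _ := logStar_iterate_two_pow_le _ L
    _ ≤ logStar ((2 ^ 2 ^ n : ℕ) : ℝ) + L := by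
      gcongr
      exact logStar_mono (Nat.cast_le.2 (eight_mul_sq_add_three_le hn))
    _ ≤ _ := by
      have h1 := logStar_two_pow_le (2 ^ n)
      have h2 := logStar_two_pow_le n
      omega

/-! ### Averages over finite sets -/

/-- Replacing a function by its means over the fibers of `f` does not change its mean. -/
theorem expect_filter_fiber {R B : Type*} [DecidableEq B] (D : Finset R) (f : R → B) (g : R → ℝ) :
    D.expect (fun r => (D.filter fun q => f q = f r).expect g) = D.expect g := by
  simp only [Finset.expect_eq_sum_div_card]
  congr 1
  simp only [Finset.sum_div, Finset.sum_filter]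
  rw [Finset.sum_comm]
  refine Finset.sum_congr rfl fun q hq => ?_
  have h : ∀ r ∈ D, (if f q = f r then g q else 0) / ((D.filter fun q => f q = f r).card : ℝ) =
      if f r = f q then g q / ((D.filter fun r => f r = f q).card : ℝ) else 0 := by
    intro r _
    by_cases h : f q = f r
    · simp [h]
    · simp [h, Ne.symm h]
  rw [Finset.sum_congr rfl h, ← Finset.sum_filter, Finset.sum_const, nsmul_eq_mul]
  have : ((D.filter fun r => f r = f q).card : ℝ) ≠ 0 :=
    Nat.cast_ne_zero.2 (Finset.card_ne_zero_of_mem (Finset.mem_filter.2 ⟨hq, rfl⟩))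
  field_simp

/-- Two finite populations `C` and `C'` carry partial labels. If the frequency of each label in
`C'` exceeds that in `C` by at most `κ`, and for each label the mean of `F'` over the members of
`C'` with this label exceeds the mean of `F` over those of `C` by at most `e`, then the total mean
of `F'` exceeds that of `F` by at most `e + κ * card Λ`. Unlabelled members have `F' = 0`. -/
theorem expect_le_expect_of_labels {R R' Λ : Type*} [Fintype Λ] [DecidableEq (Option Λ)]
    {C : Finset R} {C' : Finset R'}
    (hC : C.Nonempty) (l : R → Option Λ) (l' : R' → Option Λ) (F : R → ℝ)
    (F' : R' → ℝ) {e κ : ℝ} (he : 0 ≤ e) (hκ : 0 ≤ κ) (hF : ∀ r ∈ C, 0 ≤ F r)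
    (hF' : ∀ r ∈ C', 0 ≤ F' r) (hF'1 : ∀ r ∈ C', F' r ≤ 1) (hnone : ∀ r ∈ C', l' r = none → F' r = 0)
    (hfreq : ∀ a, ((C'.filter fun r => l' r = some a).card : ℝ) / C'.card ≤
      ((C.filter fun r => l r = some a).card : ℝ) / C.card + κ)
    (hmean : ∀ a, (C'.filter fun r => l' r = some a).Nonempty →
      (C.filter fun r => l r = some a).Nonempty →
      (C'.filter fun r => l' r = some a).expect F' ≤
        (C.filter fun r => l r = some a).expect F + e) :
    C'.expect F' ≤ C.expect F + (e + κ * Fintype.card Λ) := by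
  have hc : (0 : ℝ) < C.card := Nat.cast_pos.2 hC.card_pos
  set p : Λ → ℝ := fun a => ((C.filter fun r => l r = some a).card : ℝ) / C.card with hp
  have hp0 : ∀ a, 0 ≤ p a := fun a => by positivity
  -- Only the labelled members matter for `F'`, and those of `C` already suffice for `F`.
  have h1 : C'.expect F' = ∑ a, (∑ r ∈ C' with l' r = some a, F' r) / C'.card := by
    rw [Finset.expect_eq_sum_div_card, ← Finset.sum_div,
      ← Finset.sum_fiberwise C' l' F', Fintype.sum_option]
    rw [Finset.sum_eq_zero (s := C'.filter fun r => l' r = none), zero_add]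
    intro r hr
    exact hnone r (Finset.mem_filter.1 hr).1 (Finset.mem_filter.1 hr).2
  have h2 : ∑ a, (∑ r ∈ C with l r = some a, F r) / C.card ≤ C.expect F := by
    rw [Finset.expect_eq_sum_div_card, ← Finset.sum_div,
      ← Finset.sum_fiberwise C l F, Fintype.sum_option]
    refine div_le_div_of_nonneg_right (le_add_of_nonneg_left ?_) hc.le
    exact Finset.sum_nonneg fun r hr => hF r (Finset.mem_filter.1 hr).1
  have h3 : ∑ a, p a ≤ 1 := by
    simp only [hp]
    rw [← Finset.sum_div, div_le_one hc]
    have h := Finset.sum_fiberwise C l fun _ => (1 : ℝ)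
    rw [Fintype.sum_option] at h
    simp only [Finset.sum_const, nsmul_eq_mul, mul_one] at h
    have : (0 : ℝ) ≤ ((C.filter fun r => l r = none).card : ℝ) := by positivity
    linarith
  have h4 : ∀ a, (∑ r ∈ C' with l' r = some a, F' r) / C'.card ≤
      (∑ r ∈ C with l r = some a, F r) / C.card + (p a * e + κ) := by
    intro a
    set D := C.filter fun r => l r = some a with hD
    set D' := C'.filter fun r => l' r = some a with hD'
    have hpa : p a = (D.card : ℝ) / C.card := rfl
    have hDF : 0 ≤ ∑ r ∈ D, F r :=
      Finset.sum_nonneg fun r hr => hF r (Finset.mem_filter.1 hr).1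
    have hfr := hfreq a
    rcases D'.eq_empty_or_nonempty with hE | hE
    · rw [hE, Finset.sum_empty, zero_div]
      have := hp0 a
      positivity
    have hd' : (0 : ℝ) < D'.card := Nat.cast_pos.2 hE.card_pos
    -- The mean of `F'` over this label.
    set m := D'.expect F' with hm
    have hm0 : 0 ≤ m := Finset.expect_nonneg fun r hr => hF' r (Finset.mem_filter.1 hr).1
    have hm1 : m ≤ 1 := Finset.expect_le hE fun r hr => hF'1 r (Finset.mem_filter.1 hr).1
    have hsum : ∑ r ∈ D', F' r = D'.card * m := (Finset.card_mul_expect _ _).symm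
    have hpm : p a * m ≤ (∑ r ∈ D, F r) / C.card + p a * e := by
      rcases D.eq_empty_or_nonempty with hE2 | hE2
      · rw [hpa, hE2]; simp
      · have h := hmean a hE hE2
        rw [← Finset.card_mul_expect, hpa]
        have h5 : (D.card : ℝ) / C.card * m ≤ (D.card : ℝ) / C.card * (D.expect F + e) :=
          mul_le_mul_of_nonneg_left h (by positivity)
        calc _ ≤ _ := h5
          _ = _ := by ring
    calc _ = (D'.card : ℝ) / C'.card * m := by rw [hsum]; ring
      _ ≤ (p a + κ) * m := mul_le_mul_of_nonneg_right hfr hm0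
      _ ≤ _ := by nlinarith
  calc _ = _ := h1
    _ ≤ ∑ a, ((∑ r ∈ C with l r = some a, F r) / C.card + (p a * e + κ)) :=
      Finset.sum_le_sum fun a _ => h4 a
    _ = ∑ a, (∑ r ∈ C with l r = some a, F r) / C.card + ((∑ a, p a) * e + κ * Fintype.card Λ) := by
      rw [Finset.sum_add_distrib, Finset.sum_add_distrib, Finset.sum_mul, Finset.sum_const,
        nsmul_eq_mul, Finset.card_univ, mul_comm κ]
    _ ≤ _ := by nlinarith

/-- Probabilities that agree after rounding down to multiples of `1 / K` differ by at most
`1 / K`. -/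
theorem div_le_div_add_of_rounding_eq {K a c a' c' : ℕ} (hK : 0 < K) (hc : 0 < c) (hc' : 0 < c')
    (h : K * a' / c' = K * a / c) : (a' : ℝ) / c' ≤ (a : ℝ) / c + 1 / K := by
  have h1 : K * a' < (K * a / c + 1) * c' := by
    rw [← h, mul_comm _ c']; exact Nat.lt_mul_div_succ _ hc'
  have h2 : K * a / c * c ≤ K * a := Nat.div_mul_le_self _ _
  set q := K * a / c
  have hK' : (0 : ℝ) < K := Nat.cast_pos.2 hK
  have hcr : (0 : ℝ) < c := Nat.cast_pos.2 hc
  have hcr' : (0 : ℝ) < c' := Nat.cast_pos.2 hc'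
  have h1' : (K : ℝ) * a' ≤ (q + 1) * c' := by exact_mod_cast h1.le
  have h2' : (q : ℝ) * c ≤ K * a := by exact_mod_cast h2
  have h3 : (a' : ℝ) / c' ≤ (q + 1) / K := by
    rw [div_le_div_iff₀ hcr' hK']; linarith
  have h4 : (q : ℝ) / K ≤ a / c := by
    rw [div_le_div_iff₀ hK' hcr]; linarith
  rw [add_div] at h3
  linarith

/-! ### Probabilities of events -/

namespace PMF

theorem prob_nonneg {α : Type*} (p : PMF α) (A : Set α) : 0 ≤ p.prob A := ENNReal.toReal_nonneg

theorem toOuterMeasure_le_one {α : Type*} (p : PMF α) (A : Set α) : p.toOuterMeasure A ≤ 1 := by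
  rw [toOuterMeasure_apply, ← p.tsum_coe]
  exact ENNReal.tsum_le_tsum fun a => Set.indicator_le_self _ _ a

theorem prob_le_one {α : Type*} (p : PMF α) (A : Set α) : p.prob A ≤ 1 :=
  ENNReal.toReal_le_of_le_ofReal zero_le_one (by simpa using p.toOuterMeasure_le_one A)

theorem prob_mono {α : Type*} (p : PMF α) {A B : Set α} (h : A ⊆ B) : p.prob A ≤ p.prob B :=
  ENNReal.toReal_mono ((p.toOuterMeasure_le_one B).trans_lt ENNReal.one_lt_top).ne
    (p.toOuterMeasure.mono h)

open scoped Classical in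
theorem prob_pure {α : Type*} (a : α) (A : Set α) :
    (PMF.pure a).prob A = if a ∈ A then 1 else 0 := by
  rw [prob, toOuterMeasure_pure_apply]
  split_ifs <;> simp

theorem one_sub_prob_compl_le {α : Type*} (p : PMF α) (A : Set α) : 1 - p.prob Aᶜ ≤ p.prob A := by
  have h : (1 : ENNReal) ≤ p.toOuterMeasure A + p.toOuterMeasure Aᶜ := by
    refine le_trans (le_of_eq ?_) (MeasureTheory.measure_union_le A Aᶜ)
    rw [Set.union_compl_self, eq_comm, toOuterMeasure_apply_eq_one_iff]
    exact Set.subset_univ _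
  have h1 := ((p.toOuterMeasure_le_one A).trans_lt ENNReal.one_lt_top).ne
  have h2 := ((p.toOuterMeasure_le_one Aᶜ).trans_lt ENNReal.one_lt_top).ne
  have h3 := ENNReal.toReal_mono (ENNReal.add_ne_top.2 ⟨h1, h2⟩) h
  rw [ENNReal.toReal_add h1 h2, ENNReal.toReal_one] at h3
  simp only [prob]
  linarith

theorem prob_bind {α β : Type*} [Fintype α] (p : PMF α) (f : α → PMF β) (A : Set β) :
    (p.bind f).prob A = ∑ a, (p a).toReal * (f a).prob A := by
  rw [prob, toOuterMeasure_bind_apply, tsum_fintype, ENNReal.toReal_sum]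
  · simp only [ENNReal.toReal_mul, prob]
  · intro a _
    exact ENNReal.mul_ne_top (p.apply_ne_top a)
      (((f a).toOuterMeasure_le_one A).trans_lt ENNReal.one_lt_top).ne

theorem sum_toReal {α : Type*} [Fintype α] (p : PMF α) : ∑ a, (p a).toReal = 1 := by
  rw [← ENNReal.toReal_sum fun a _ => p.apply_ne_top a, ← tsum_fintype (L := .unconditional _),
    p.tsum_coe, ENNReal.toReal_one]

theorem prob_uniformOfFinset_bind {α β : Type*} [Fintype α] {s : Finset α} (hs : s.Nonempty)
    (f : α → PMF β) (A : Set β) :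
    ((uniformOfFinset s hs).bind f).prob A = s.expect fun a => (f a).prob A := by
  classical
  rw [prob_bind, Finset.expect_eq_sum_div_card, Finset.sum_div]
  simp only [uniformOfFinset_apply]
  rw [← Finset.sum_subset (Finset.subset_univ s)]
  · refine Finset.sum_congr rfl fun a ha => ?_
    simp [ha, div_eq_inv_mul]
  · intro a _ ha
    simp [ha]

theorem prob_uniformOfFintype_bind {α β : Type*} [Fintype α] [Nonempty α] (f : α → PMF β)
    (A : Set β) :
    ((uniformOfFintype α).bind f).prob A = Finset.univ.expect fun a => (f a).prob A :=
  prob_uniformOfFinset_bind Finset.univ_nonempty f A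

end PMF

/-! ### Profiles of Alice -/

/-- The codes of Alice's possible behaviours with a given number of flows to go: the code for
`k + 1` flows assigns to each pair of (the code of) a word and a code for `k` flows a multiple of
`1 / K k`, of which the numerator is recorded. In a flow of Alice, this is the probability that she
sends the word and is left with the second code; in a flow of Bob, it is `1` or `0` according to
whether some message from Bob leads to the second code. -/
def Profile.{u} (W : Type u) (K : ℕ → ℕ) : ℕ → Type u
  | 0 => PUnit
  | k + 1 => W × Profile W K k → Fin (K k + 1)

instance Profile.instFinite (W : Type*) [Finite W] (K : ℕ → ℕ) : ∀ k, Finite (Profile W K k)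
  | 0 => inferInstanceAs (Finite PUnit)
  | k + 1 =>
    have := Profile.instFinite W K k
    inferInstanceAs (Finite (W × Profile W K k → Fin (K k + 1)))

noncomputable instance Profile.instFintype (W : Type*) [Finite W] (K : ℕ → ℕ) (k : ℕ) :
    Fintype (Profile W K k) := Fintype.ofFinite _

theorem Profile.natCard (W : Type*) [Finite W] (D k : ℕ) :
    Nat.card (Profile W (profileGrid (Nat.card W) D) k) = profileCount (Nat.card W) D k := by
  induction k with
  | zero => exact Nat.card_eq_one_iff_unique.2 ⟨inferInstanceAs (Subsingleton PUnit), ⟨PUnit.unit⟩⟩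
  | succ k ih =>
    have h : Nat.card (Profile W (profileGrid (Nat.card W) D) (k + 1)) = Nat.card
      (W × Profile W (profileGrid (Nat.card W) D) k → Fin (profileGrid (Nat.card W) D k + 1)) := rfl
    rw [h, Nat.card_fun, Nat.card_prod, ih, Nat.card_fin]
    rfl

/-- The code of a word over `X` of length at most `n`. -/
def wordCode {X : Type*} (n : ℕ) (l : List X) : Fin n → Option X := fun i => l[(i : ℕ)]?

theorem wordCode_ofFn_injective {X : Type*} {n m : ℕ} (hm : m ≤ n) {x y : Fin m → X}
    (h : wordCode n (List.ofFn x) = wordCode n (List.ofFn y)) : x = y := by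
  funext i
  have := congrFun h ⟨i, i.2.trans_le hm⟩
  simpa [wordCode] using this

namespace AuthProtocol

variable {X Z S M : Type*} {L : ℕ}

/-- What Alice sends in flow `j` (`none` if she rejects), with the word as a list. -/
def sent (P : AuthProtocol X Z S M L) (j : ℕ) (s : S) (view : List M) (r : Fin P.tapeA → Bool) :
    Option (List X × M) :=
  (P.alice j s r view).map fun p => (List.ofFn p.1, p.2)

open scoped Classical in
/-- The tapes in `C` with which Alice sends `y` in flow `j`. -/
noncomputable def fiber (P : AuthProtocol X Z S M L) (j : ℕ) (s : S)
    (C : Finset (Fin P.tapeA → Bool)) (view : List M) (y : Option (List X × M)) :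
    Finset (Fin P.tapeA → Bool) :=
  C.filter fun r => P.sent j s view r = y

/-- The code of the word that Alice sends in flow `j` with tape `r`, and the value of `τ` at the set
of tapes in `C` that are compatible with her sending what she does. -/
noncomputable def label {W T : Type*} (P : AuthProtocol X Z S M L) (enc : List X → W)
    (τ : Finset (Fin P.tapeA → Bool) → T) (j : ℕ) (s : S) (C : Finset (Fin P.tapeA → Bool))
    (view : List M) (r : Fin P.tapeA → Bool) : Option (W × T) :=
  (P.sent j s view r).map fun y => (enc y.1, τ (P.fiber j s C view (some y)))

open scoped Classical in
/-- The code of an Alice with source state `s` and `k` flows to go, the next one being flow `j`, who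
has received `view` and whose tape is uniformly distributed on `C`. -/
noncomputable def profile {W : Type*} (P : AuthProtocol X Z S M L) (enc : List X → W) (K : ℕ → ℕ)
    (s : S) : (k : ℕ) → ℕ → List M → Finset (Fin P.tapeA → Bool) → Profile W K k
  | 0, _, _, _ => PUnit.unit
  | k + 1, j, view, C => fun a =>
    if P.aliceSends j then
      Fin.ofNat (K k + 1)
        (K k * (C.filter fun r =>
          P.label enc (P.profile enc K s k (j + 1) view) j s C view r = some a).card / C.card)
    else if ∃ v, P.profile enc K s k (j + 1) (view ++ [v]) C = a.2 then Fin.last (K k) else 0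

open scoped Classical in
/-- Equality of profiles before a flow of Alice: the frequencies of the labels nearly agree. -/
theorem label_frequency_le {W : Type*} {P : AuthProtocol X Z S M L} {enc : List X → W}
    {K : ℕ → ℕ} {s s' : S} {k j : ℕ} {view view' : List M} {C C' : Finset (Fin P.tapeA → Bool)}
    (hK : 0 < K k) (hC : C.Nonempty) (hC' : C'.Nonempty) (hj : P.aliceSends j = true)
    (h : P.profile enc K s (k + 1) j view C = P.profile enc K s' (k + 1) j view' C')
    (a : W × Profile W K k) :
    ((C'.filter fun r => P.label enc (P.profile enc K s' k (j + 1) view') j s' C' view' r =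
        some a).card : ℝ) / C'.card ≤
      ((C.filter fun r => P.label enc (P.profile enc K s k (j + 1) view) j s C view r =
        some a).card : ℝ) / C.card + 1 / K k := by
  refine div_le_div_add_of_rounding_eq hK hC.card_pos hC'.card_pos ?_
  have h1 := congrArg Fin.val (congrFun h a)
  simp only [profile, hj, if_true] at h1
  have hle : ∀ (E : Finset (Fin P.tapeA → Bool)) (p : (Fin P.tapeA → Bool) → Prop)
      [DecidablePred p],
      K k * (E.filter p).card / E.card < K k + 1 := fun E p _ =>
    Nat.lt_succ_of_le (Nat.div_le_of_le_mul (by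
      rw [mul_comm E.card]; exact Nat.mul_le_mul_left _ (Finset.card_filter_le _ _)))
  simp only [Fin.ofNat] at h1
  rw [Nat.mod_eq_of_lt (hle _ _), Nat.mod_eq_of_lt (hle _ _)] at h1
  exact h1.symm

/-- Equality of profiles before a flow of Bob: whatever message one Alice receives, the other one
can be given a message after which the profiles agree again. -/
theorem exists_profile_append_eq {W : Type*} [Nonempty W] {P : AuthProtocol X Z S M L}
    {enc : List X → W} {K : ℕ → ℕ} {s s' : S} {k j : ℕ} {view view' : List M}
    {C C' : Finset (Fin P.tapeA → Bool)} (hK : 0 < K k) (hj : P.aliceSends j = false)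
    (h : P.profile enc K s (k + 1) j view C = P.profile enc K s' (k + 1) j view' C') (v : M) :
    ∃ v', P.profile enc K s k (j + 1) (view ++ [v']) C =
      P.profile enc K s' k (j + 1) (view' ++ [v]) C' := by
  classical
  have h1 := congrFun h (Classical.arbitrary W, P.profile enc K s' k (j + 1) (view' ++ [v]) C')
  simp only [profile, hj, if_false, Bool.false_eq_true] at h1
  rw [if_pos (⟨v, rfl⟩ : ∃ w, P.profile enc K s' k (j + 1) (view' ++ [w]) C' = _)] at h1
  by_contra hn
  rw [if_neg hn] at h1
  exact hK.ne (congrArg Fin.val h1)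

/-! ### Impersonation of another source state -/

/-- The state of Oscar's attack: the number of flows so far, the tapes of Alice that are compatible
with what he has seen and the list of messages that she has received, and likewise for the simulated
Alice whom he presents to Bob. -/
structure Impersonation (P : AuthProtocol X Z S M L) where
  flow : ℕ
  tapes : Finset (Fin P.tapeA → Bool)
  view : List M
  simTapes : Finset (Fin P.tapeA → Bool)
  simView : List M

/-- The update of Oscar's state. He delivers to Bob what the simulated Alice sends, while the
simulated Alice receives what Bob sends. -/
noncomputable def Impersonation.next {P : AuthProtocol X Z S M L} (s s' : S)
    (σ : P.Impersonation) : OscarEvent X Z M → P.Impersonation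
  | .aliceFlow x _ u u' =>
    { flow := σ.flow + 1
      tapes := P.fiber σ.flow s σ.tapes σ.view (some (x, u))
      view := σ.view
      simTapes := P.fiber σ.flow s' σ.simTapes σ.simView (some (x, u'))
      simView := σ.simView }
  | .bobFlow v v' =>
    { flow := σ.flow + 1
      tapes := σ.tapes
      view := σ.view ++ [v']
      simTapes := σ.simTapes
      simView := σ.simView ++ [v] }

/-- Oscar's state after the given events. -/
noncomputable def impersonation (P : AuthProtocol X Z S M L) (s s' : S)
    (events : List (OscarEvent X Z M)) : P.Impersonation :=
  events.foldl (Impersonation.next s s') ⟨0, Finset.univ, [], Finset.univ, []⟩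

theorem impersonation_append (P : AuthProtocol X Z S M L) (s s' : S)
    (events : List (OscarEvent X Z M)) (e : OscarEvent X Z M) :
    P.impersonation s s' (events ++ [e]) = (P.impersonation s s' events).next s s' e := by
  simp [impersonation]

open scoped Classical in
/-- The compatible tapes of the simulated Alice with which she sends the same word as Alice and then
has the same profile, for `k` flows to go, as Alice if Alice sends `y`. -/
noncomputable def Impersonation.matching {W : Type*} {P : AuthProtocol X Z S M L}
    (σ : P.Impersonation) (enc : List X → W) (K : ℕ → ℕ) (s s' : S) (k : ℕ) (y : List X × M) :
    Finset (Fin P.tapeA → Bool) :=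
  σ.simTapes.filter fun r =>
    P.label enc (P.profile enc K s' k (σ.flow + 1) σ.simView) σ.flow s' σ.simTapes σ.simView r =
      some (enc y.1, P.profile enc K s k (σ.flow + 1) σ.view
        (P.fiber σ.flow s σ.tapes σ.view (some y)))

open scoped Classical in
/-- The type I attack on Alice with source state `s` that simulates an Alice with source state `s'`
towards Bob and keeps the profiles of both equal. In a flow of Alice, Oscar picks a uniformly random
matching tape of the simulated Alice and delivers what she sends with it; in a flow of Bob, he
delivers a message after which the profiles agree. -/
noncomputable def impersonate {W : Type*} (P : AuthProtocol X Z S M L) (enc : List X → W)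
    (K : ℕ → ℕ) (s s' : S) : TypeIAttack X Z M where
  toBob events x _ u :=
    let σ := P.impersonation s s' events
    if h : (σ.matching enc K s s' (L - (σ.flow + 1)) (x, u)).Nonempty then
      (PMF.uniformOfFinset _ h).map fun r =>
        ((P.sent σ.flow s' σ.simView r).map Prod.snd).getD u
    else PMF.pure u
  toAlice events v :=
    let σ := P.impersonation s s' events
    let k := L - (σ.flow + 1)
    PMF.pure (if h : ∃ v', P.profile enc K s k (σ.flow + 1) (σ.view ++ [v']) σ.tapes =
      P.profile enc K s' k (σ.flow + 1) (σ.simView ++ [v]) σ.simTapes then h.choose else v)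

theorem toBob_impersonate {W : Type*} {P : AuthProtocol X Z S M L} {enc : List X → W}
    {K : ℕ → ℕ} {s s' : S} {k : ℕ} {viewO : List (OscarEvent X Z M)} {σ : P.Impersonation}
    (hσ : P.impersonation s s' viewO = σ) (hk : L - (σ.flow + 1) = k) {x : List X} {z : List Z}
    {u : M} (hne : (σ.matching enc K s s' k (x, u)).Nonempty) :
    (P.impersonate enc K s s').toBob viewO x z u = (PMF.uniformOfFinset _ hne).map fun r =>
      ((P.sent σ.flow s' σ.simView r).map Prod.snd).getD u := by
  subst hσ hk
  simp only [impersonate]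
  rw [dif_pos hne]

theorem exists_toAlice_impersonate {W : Type*} {P : AuthProtocol X Z S M L} {enc : List X → W}
    {K : ℕ → ℕ} {s s' : S} {k : ℕ} {viewO : List (OscarEvent X Z M)} {σ : P.Impersonation}
    (hσ : P.impersonation s s' viewO = σ) (hk : L - (σ.flow + 1) = k) {v : M}
    (hex : ∃ v', P.profile enc K s k (σ.flow + 1) (σ.view ++ [v']) σ.tapes =
      P.profile enc K s' k (σ.flow + 1) (σ.simView ++ [v]) σ.simTapes) :
    ∃ v', (P.impersonate enc K s s').toAlice viewO v = PMF.pure v' ∧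
      P.profile enc K s k (σ.flow + 1) (σ.view ++ [v']) σ.tapes =
        P.profile enc K s' k (σ.flow + 1) (σ.simView ++ [v]) σ.simTapes := by
  subst hσ hk
  refine ⟨hex.choose, ?_, hex.choose_spec⟩
  simp only [impersonate]
  rw [dif_pos hex]

theorem mem_fiber {P : AuthProtocol X Z S M L} {j : ℕ} {s : S} {C : Finset (Fin P.tapeA → Bool)}
    {view : List M} {y : Option (List X × M)} {r : Fin P.tapeA → Bool} :
    r ∈ P.fiber j s C view y ↔ r ∈ C ∧ P.sent j s view r = y := by
  simp [fiber]

theorem sent_eq_some_iff {P : AuthProtocol X Z S M L} {j : ℕ} {s : S} {view : List M}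
    {r : Fin P.tapeA → Bool} {x : Fin (P.uses j) → X} {u : M} :
    P.sent j s view r = some (List.ofFn x, u) ↔ P.alice j s r view = some (x, u) := by
  rcases h : P.alice j s r view with _ | ⟨x', u'⟩
  · simp [sent, h]
  · simp [sent, h, List.ofFn_injective.eq_iff]

/-- The label is determined by what is sent, so that the set of tapes with a given label is a union
of fibers. -/
theorem filter_label_filter_sent {W T : Type*} [DecidableEq (Option (W × T))]
    [DecidableEq (Option (List X × M))] {P : AuthProtocol X Z S M L}
    {enc : List X → W} {τ : Finset (Fin P.tapeA → Bool) → T} {j : ℕ} {s : S}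
    {C : Finset (Fin P.tapeA → Bool)} {view : List M} {a : Option (W × T)}
    {r : Fin P.tapeA → Bool} (hr : P.label enc τ j s C view r = a) :
    ((C.filter fun q => P.label enc τ j s C view q = a).filter fun q =>
      P.sent j s view q = P.sent j s view r) = P.fiber j s C view (P.sent j s view r) := by
  ext q
  simp only [Finset.mem_filter, mem_fiber]
  refine ⟨fun h => ⟨h.1.1, h.2⟩, fun h => ⟨⟨h.1, ?_⟩, h.2⟩⟩
  rw [← hr, label, label, h.2]

theorem uses_le_numUses {P : AuthProtocol X Z S M L} {j : ℕ} (hL : j < L)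
    (hj : P.aliceSends j = true) : P.uses j ≤ P.numUses := by
  have h := Finset.single_le_sum (f := fun j => if P.aliceSends j = true then P.uses j else 0)
    (fun _ _ => Nat.zero_le _) (Finset.mem_range.2 hL)
  simpa [hj, numUses] using h

/-! ### The success probability of the impersonation -/

variable [Fintype Z]

theorem runI_alice_none {P : AuthProtocol X Z S M L} {W₁ : X → PMF Z}
    {O : TypeIAttack X Z M} {s : S} {rA : Fin P.tapeA → Bool} {rB : Fin P.tapeB → Bool}
    {k j : ℕ} {viewA : List M} {viewB : List (List Z × M)} {viewO : List (OscarEvent X Z M)}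
    (hj : P.aliceSends j = true) (h : P.alice j s rA viewA = none) :
    P.runI W₁ O s rA rB (k + 1) j viewA viewB viewO = PMF.pure none := by
  simp only [runI, hj, if_true]
  rw [h]

theorem runI_alice_some {P : AuthProtocol X Z S M L} {W₁ : X → PMF Z}
    {O : TypeIAttack X Z M} {s : S} {rA : Fin P.tapeA → Bool} {rB : Fin P.tapeB → Bool}
    {k j : ℕ} {viewA : List M} {viewB : List (List Z × M)} {viewO : List (OscarEvent X Z M)}
    {x : Fin (P.uses j) → X} {u : M}
    (hj : P.aliceSends j = true) (h : P.alice j s rA viewA = some (x, u)) :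
    P.runI W₁ O s rA rB (k + 1) j viewA viewB viewO =
      (dmc W₁ x).bind fun z =>
        (O.toBob viewO (List.ofFn x) (List.ofFn z) u).bind fun u' =>
        P.runI W₁ O s rA rB k (j + 1) viewA (viewB ++ [(List.ofFn z, u')])
          (viewO ++ [.aliceFlow (List.ofFn x) (List.ofFn z) u u']) := by
  simp only [runI, hj, if_true]
  rw [h]

theorem runI_bob_none {P : AuthProtocol X Z S M L} {W₁ : X → PMF Z}
    {O : TypeIAttack X Z M} {s : S} {rA : Fin P.tapeA → Bool} {rB : Fin P.tapeB → Bool}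
    {k j : ℕ} {viewA : List M} {viewB : List (List Z × M)} {viewO : List (OscarEvent X Z M)}
    (hj : P.aliceSends j = false) (h : P.bob j rB viewB = none) :
    P.runI W₁ O s rA rB (k + 1) j viewA viewB viewO = PMF.pure none := by
  simp only [runI, hj, Bool.false_eq_true, if_false]
  rw [h]

theorem runI_bob_some {P : AuthProtocol X Z S M L} {W₁ : X → PMF Z}
    {O : TypeIAttack X Z M} {s : S} {rA : Fin P.tapeA → Bool} {rB : Fin P.tapeB → Bool}
    {k j : ℕ} {viewA : List M} {viewB : List (List Z × M)} {viewO : List (OscarEvent X Z M)}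
    {v : M} (hj : P.aliceSends j = false) (h : P.bob j rB viewB = some v) :
    P.runI W₁ O s rA rB (k + 1) j viewA viewB viewO =
      (O.toAlice viewO v).bind fun v' =>
        P.runI W₁ O s rA rB k (j + 1) (viewA ++ [v']) viewB (viewO ++ [.bobFlow v v']) := by
  simp only [runI, hj, Bool.false_eq_true, if_false]
  rw [h]

open scoped Classical in
/-- The effect of the impersonation in a flow of Alice, on the tapes with which she sends `(x, u)`:
compared with an execution between the simulated Alice, restricted to the tapes matching `(x, u)`,
and Bob, no more than `e` is lost if no more than `e` is lost in the remaining flows. -/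
theorem expect_matching_le {W : Type*} {P : AuthProtocol X Z S M L} {W₁ : X → PMF Z}
    {enc : List X → W} {K : ℕ → ℕ} {s s' : S} {rB : Fin P.tapeB → Bool} {k j : ℕ} {e : ℝ}
    {viewB : List (List Z × M)} {viewO viewO' : List (OscarEvent X Z M)} {σ : P.Impersonation}
    (hσ : P.impersonation s s' viewO = σ) (hflow : σ.flow = j) (hL : j + (k + 1) = L)
    (hj : P.aliceSends j = true)
    (henc : ∀ x y : Fin (P.uses j) → X, enc (List.ofFn x) = enc (List.ofFn y) → x = y)
    {x : Fin (P.uses j) → X} {u : M}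
    (hne : (P.fiber j s σ.tapes σ.view (some (List.ofFn x, u))).Nonempty)
    (hne' : (σ.matching enc K s s' k (List.ofFn x, u)).Nonempty)
    (ih : ∀ (z : Fin (P.uses j) → Z) (u' : M) (viewO'' : List (OscarEvent X Z M)),
      (P.fiber j s' σ.simTapes σ.simView (some (List.ofFn x, u'))).Nonempty →
      P.profile enc K s k (j + 1) σ.view (P.fiber j s σ.tapes σ.view (some (List.ofFn x, u))) =
        P.profile enc K s' k (j + 1) σ.simView
          (P.fiber j s' σ.simTapes σ.simView (some (List.ofFn x, u'))) →
      ((P.fiber j s' σ.simTapes σ.simView (some (List.ofFn x, u'))).expect fun r =>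
        (P.runI W₁ (TypeIAttack.passive X Z M) s' r rB k (j + 1) σ.simView
          (viewB ++ [(List.ofFn z, u')]) viewO'').prob {some s'}) ≤
      ((P.fiber j s σ.tapes σ.view (some (List.ofFn x, u))).expect fun r =>
        (P.runI W₁ (P.impersonate enc K s s') s r rB k (j + 1) σ.view
          (viewB ++ [(List.ofFn z, u')])
          (viewO ++ [.aliceFlow (List.ofFn x) (List.ofFn z) u u'])).prob {some s'}) + e) :
    ((σ.matching enc K s s' k (List.ofFn x, u)).expect fun r =>
      (P.runI W₁ (TypeIAttack.passive X Z M) s' r rB (k + 1) j σ.simView viewB viewO').prob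
        {some s'}) ≤
    ((P.fiber j s σ.tapes σ.view (some (List.ofFn x, u))).expect fun r =>
      (P.runI W₁ (P.impersonate enc K s s') s r rB (k + 1) j σ.view viewB viewO).prob
        {some s'}) + e := by
  set D' := σ.matching enc K s s' k (List.ofFn x, u) with hD'
  set C := P.fiber j s σ.tapes σ.view (some (List.ofFn x, u)) with hC
  -- The simulated Alice sends the word `x` with every matching tape.
  have hD'_mem : ∀ r ∈ D', r ∈ σ.simTapes ∧ ∃ u', P.alice j s' r σ.simView = some (x, u') ∧
      P.profile enc K s' k (j + 1) σ.simView
          (P.fiber j s' σ.simTapes σ.simView (some (List.ofFn x, u'))) =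
        P.profile enc K s k (j + 1) σ.view C := by
    intro r hr
    simp only [hD', Impersonation.matching, Finset.mem_filter, hflow] at hr
    refine ⟨hr.1, ?_⟩
    have hl := hr.2
    rcases hal : P.alice j s' r σ.simView with _ | ⟨x', u'⟩
    · simp [label, sent, hal] at hl
    · have hsent := sent_eq_some_iff.2 hal
      rw [label, hsent, Option.map_some, Option.some_inj, Prod.mk.injEq] at hl
      obtain rfl := henc _ _ hl.1
      exact ⟨u', rfl, hl.2⟩
  set msg : (Fin P.tapeA → Bool) → M := fun r =>
    ((P.sent j s' σ.simView r).map Prod.snd).getD u with hmsg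
  have hmsg_eq : ∀ r u', P.alice j s' r σ.simView = some (x, u') → msg r = u' := by
    intro r u' h
    simp [hmsg, sent_eq_some_iff.2 h]
  -- The values after this flow, for an output word `z` of the channel.
  set A : (Fin P.tapeA → Bool) → (Fin (P.uses j) → Z) → M → ℝ := fun r z u' =>
    (P.runI W₁ (P.impersonate enc K s s') s r rB k (j + 1) σ.view
      (viewB ++ [(List.ofFn z, u')])
      (viewO ++ [.aliceFlow (List.ofFn x) (List.ofFn z) u u'])).prob {some s'}
  set H : (Fin P.tapeA → Bool) → (Fin (P.uses j) → Z) → M → ℝ := fun r z u' =>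
    (P.runI W₁ (TypeIAttack.passive X Z M) s' r rB k (j + 1) σ.simView
      (viewB ++ [(List.ofFn z, u')])
      (viewO' ++ [.aliceFlow (List.ofFn x) (List.ofFn z) u' u'])).prob {some s'} with hH
  have hreal : ∀ r ∈ C,
      (P.runI W₁ (P.impersonate enc K s s') s r rB (k + 1) j σ.view viewB viewO).prob {some s'} =
        ∑ z, (dmc W₁ x z).toReal * D'.expect fun r' => A r z (msg r') := by
    intro r hr
    rw [runI_alice_some hj (sent_eq_some_iff.1 (mem_fiber.1 hr).2), PMF.prob_bind]
    refine Finset.sum_congr rfl fun z _ => ?_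
    congr 1
    rw [toBob_impersonate hσ (by rw [hflow]; omega) hne', PMF.bind_map,
      PMF.prob_uniformOfFinset_bind, hflow]
    rfl
  have hsim : ∀ r ∈ D',
      (P.runI W₁ (TypeIAttack.passive X Z M) s' r rB (k + 1) j σ.simView viewB viewO').prob
        {some s'} = ∑ z, (dmc W₁ x z).toReal * H r z (msg r) := by
    intro r hr
    obtain ⟨-, u', hu', -⟩ := hD'_mem r hr
    rw [runI_alice_some hj hu', PMF.prob_bind, hmsg_eq r u' hu']
    refine Finset.sum_congr rfl fun z _ => ?_
    simp only [TypeIAttack.passive, PMF.pure_bind, hH]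
  rw [Finset.expect_congr rfl hsim, Finset.expect_congr rfl hreal, Finset.expect_sum_comm,
    Finset.expect_sum_comm]
  have hz : ∀ z, (D'.expect fun r => H r z (msg r)) ≤
      (C.expect fun r => D'.expect fun r' => A r z (msg r')) + e := by
    intro z
    -- Averaging over the tapes with which the same message is sent does not change the mean.
    rw [← expect_filter_fiber D' (P.sent j s' σ.simView) fun r => H r z (msg r),
      Finset.expect_comm, ← Finset.expect_const hne' e, ← Finset.expect_add_distrib]
    refine Finset.expect_le_expect fun r hr => ?_
    obtain ⟨hr1, u', hu', hp⟩ := hD'_mem r hr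
    have hsent := sent_eq_some_iff.2 hu'
    have hfib : (D'.filter fun q => P.sent j s' σ.simView q = P.sent j s' σ.simView r) =
        P.fiber j s' σ.simTapes σ.simView (some (List.ofFn x, u')) := by
      rw [← hsent]
      simp only [hD', Impersonation.matching, hflow] at hr ⊢
      exact filter_label_filter_sent (Finset.mem_filter.1 hr).2
    have hmsgr := hmsg_eq r u' hu'
    rw [hfib, hmsgr]
    have hcongr : ∀ q ∈ P.fiber j s' σ.simTapes σ.simView (some (List.ofFn x, u')),
        H q z (msg q) = H q z u' := fun q hq => by
      rw [hmsg_eq q u' (sent_eq_some_iff.1 (mem_fiber.1 hq).2)]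
    rw [Finset.expect_congr rfl hcongr]
    exact ih z u' _ ⟨r, mem_fiber.2 ⟨hr1, hsent⟩⟩ hp.symm
  calc _ = ∑ z, (dmc W₁ x z).toReal * D'.expect fun r => H r z (msg r) :=
      Finset.sum_congr rfl fun z _ => (Finset.mul_expect _ _ _).symm
    _ ≤ ∑ z, (dmc W₁ x z).toReal *
        ((C.expect fun r => D'.expect fun r' => A r z (msg r')) + e) :=
      Finset.sum_le_sum fun z _ => mul_le_mul_of_nonneg_left (hz z) ENNReal.toReal_nonneg
    _ = ∑ z, (dmc W₁ x z).toReal * (C.expect fun r => D'.expect fun r' => A r z (msg r')) + e := by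
      simp only [mul_add]
      rw [Finset.sum_add_distrib, ← Finset.sum_mul, PMF.sum_toReal, one_mul]
    _ = _ := by
      congr 1
      exact Finset.sum_congr rfl fun z _ => Finset.mul_expect _ _ _

/-- A bound for the loss in the last `k` flows of the impersonation, where words have `w` codes and
for `i` flows to go there are `c i` profiles and the denominator of the grid is `K i`: in a flow of
Alice, each of the `w * c i` transitions contributes an error of at most `1 / K i`. -/
noncomputable def roundingError (w : ℕ) (K c : ℕ → ℕ) (k : ℕ) : ℝ :=
  ∑ i ∈ Finset.range k, 1 / (K i : ℝ) * (w * c i : ℕ)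

theorem roundingError_nonneg (w : ℕ) (K c : ℕ → ℕ) (k : ℕ) : 0 ≤ roundingError w K c k :=
  Finset.sum_nonneg fun i _ => by positivity

open scoped Classical in
/-- As long as the profiles of Alice and of the simulated Alice agree, the impersonation makes Bob
output the simulated source state with almost the probability that he does so in an execution with
the simulated Alice. -/
theorem expect_passive_le_expect_impersonate {W : Type*} [Fintype W] [Nonempty W]
    {P : AuthProtocol X Z S M L}
    {W₁ : X → PMF Z} {enc : List X → W} {K : ℕ → ℕ} (hK : ∀ k, 0 < K k)
    (henc : ∀ j < L, P.aliceSends j = true →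
      ∀ x y : Fin (P.uses j) → X, enc (List.ofFn x) = enc (List.ofFn y) → x = y)
    {s s' : S} {rB : Fin P.tapeB → Bool} (k j : ℕ) (hL : j + k = L)
    {viewB : List (List Z × M)} {viewO viewO' : List (OscarEvent X Z M)} {σ : P.Impersonation}
    (hσ : P.impersonation s s' viewO = σ) (hflow : σ.flow = j) (hne : σ.tapes.Nonempty)
    (hne' : σ.simTapes.Nonempty)
    (hp : P.profile enc K s k j σ.view σ.tapes = P.profile enc K s' k j σ.simView σ.simTapes) :
    (σ.simTapes.expect fun r =>
      (P.runI W₁ (TypeIAttack.passive X Z M) s' r rB k j σ.simView viewB viewO').prob {some s'}) ≤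
    (σ.tapes.expect fun r =>
      (P.runI W₁ (P.impersonate enc K s s') s r rB k j σ.view viewB viewO).prob {some s'}) +
      roundingError (Fintype.card W) K (fun i => Fintype.card (Profile W K i)) k := by
  induction k generalizing j viewB viewO viewO' σ with
  | zero => simp only [runI, Finset.expect_const hne, Finset.expect_const hne']; simp [roundingError]
  | succ k ih =>
    rcases hj : P.aliceSends j with _ | _
    · have hmono : roundingError (Fintype.card W) K (fun i => Fintype.card (Profile W K i)) k ≤
          roundingError (Fintype.card W) K (fun i => Fintype.card (Profile W K i)) (k + 1) := by
        rw [roundingError, roundingError, Finset.sum_range_succ]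
        exact le_add_of_nonneg_right (by positivity)
      refine le_trans ?_ (add_le_add_right hmono _)
      rcases hv : P.bob j rB viewB with _ | v
      · simp only [runI_bob_none hj hv, Finset.expect_const hne, Finset.expect_const hne']
        exact le_add_of_nonneg_right (roundingError_nonneg _ _ _ _)
      · subst hflow
        obtain ⟨v', hv', hpv⟩ := exists_toAlice_impersonate hσ (show L - (σ.flow + 1) = k by omega)
          (exists_profile_append_eq (hK k) hj hp v)
        simp only [runI_bob_some hj hv, hv', TypeIAttack.passive, PMF.pure_bind]
        refine ih (σ.flow + 1) (by omega)
          (σ := ⟨σ.flow + 1, σ.tapes, σ.view ++ [v'], σ.simTapes, σ.simView ++ [v]⟩)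
          ?_ rfl hne hne' hpv
        rw [impersonation_append, hσ]
        rfl
    · have herr : roundingError (Fintype.card W) K (fun i => Fintype.card (Profile W K i)) (k + 1) =
          roundingError (Fintype.card W) K (fun i => Fintype.card (Profile W K i)) k +
            1 / (K k : ℝ) * Fintype.card (W × Profile W K k) := by
        rw [roundingError, roundingError, Finset.sum_range_succ, Fintype.card_prod]
      rw [herr]
      refine expect_le_expect_of_labels hne
        (P.label enc (P.profile enc K s k (j + 1) σ.view) j s σ.tapes σ.view)
        (P.label enc (P.profile enc K s' k (j + 1) σ.simView) j s' σ.simTapes σ.simView)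
        _ _ (roundingError_nonneg _ _ _ _) (by positivity)
        (fun _ _ => PMF.prob_nonneg _ _) (fun _ _ => PMF.prob_nonneg _ _)
        (fun _ _ => PMF.prob_le_one _ _) ?_ (label_frequency_le (hK k) hne hne' hj hp) ?_
      · intro r _ hr
        have hn : P.alice j s' r σ.simView = none := by
          simpa [label, sent] using hr
        rw [runI_alice_none hj hn, PMF.prob_pure, if_neg (by simp)]
      · intro a hD' hD
        -- Compare the mean over each set of tapes of Alice with which she sends the same.
        rw [← expect_filter_fiber (σ.tapes.filter _) (P.sent j s σ.view)]
        rw [← Finset.expect_const hD (roundingError _ _ _ _), ← Finset.expect_add_distrib,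
          ← Finset.expect_const hD (Finset.expect _ _)]
        refine Finset.expect_le_expect fun r hr => ?_
        have hrl := (Finset.mem_filter.1 hr).2
        rw [filter_label_filter_sent hrl]
        rcases hal : P.alice j s r σ.view with _ | ⟨x, u⟩
        · simp [label, sent, hal] at hrl
        have hsent := sent_eq_some_iff.2 hal
        have hmatch : (σ.simTapes.filter fun r => P.label enc
            (P.profile enc K s' k (j + 1) σ.simView) j s' σ.simTapes σ.simView r = some a) =
            σ.matching enc K s s' k (List.ofFn x, u) := by
          rw [← hrl, label, hsent]
          simp only [Impersonation.matching, hflow, Option.map_some]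
        rw [hmatch] at hD' ⊢
        rw [hsent]
        refine expect_matching_le hσ hflow hL hj (henc j (by omega) hj)
          ⟨r, mem_fiber.2 ⟨(Finset.mem_filter.1 hr).1, hsent⟩⟩ hD' ?_
        intro z u' viewO'' hne1 hp1
        refine ih (j + 1) (by omega)
          (σ := ⟨j + 1, P.fiber j s σ.tapes σ.view (some (List.ofFn x, u)), σ.view,
            P.fiber j s' σ.simTapes σ.simView (some (List.ofFn x, u')), σ.simView⟩)
          ?_ rfl ⟨r, mem_fiber.2 ⟨(Finset.mem_filter.1 hr).1, hsent⟩⟩ hne1 hp1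
        rw [impersonation_append, hσ]
        simp only [Impersonation.next, hflow]

/-! ### The number of source states -/

/-- With `profileGrid`, the losses of all flows are bounded by a geometric series. -/
theorem roundingError_profileGrid_le {w D : ℕ} (hw : 0 < w) (hD : 0 < D) (k : ℕ) :
    roundingError w (profileGrid w D) (profileCount w D) k ≤ 1 / D := by
  have hDr : (0 : ℝ) < D := Nat.cast_pos.2 hD
  have h : roundingError w (profileGrid w D) (profileCount w D) k =
      1 / D * (1 - (1 / 2 : ℝ) ^ k) := by
    induction k with
    | zero => simp [roundingError]
    | succ k ih =>
      rw [roundingError, Finset.sum_range_succ, ← roundingError, ih, profileGrid]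
      have hwr : (w : ℝ) ≠ 0 := Nat.cast_ne_zero.2 hw.ne'
      have hN : (profileCount w D k : ℝ) ≠ 0 := Nat.cast_ne_zero.2 (profileCount_pos w D k).ne'
      push_cast
      rw [pow_succ (1 / 2 : ℝ) k, one_div_pow]
      field_simp
      ring
  rw [h]
  have h1 : (0 : ℝ) ≤ (1 / 2 : ℝ) ^ k := by positivity
  have h2 : (0 : ℝ) ≤ 1 / D := by positivity
  nlinarith

/-- In a secure protocol, different source states have different profiles before the first flow:
otherwise the impersonation of one by the other succeeds with probability at least `1 - δ - 1 / D`,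
which exceeds `ε`. -/
theorem card_le_profileCount {Y : Type*} [Fintype X] [Fintype S] {P : AuthProtocol X Z S M L}
    {W₁ : X → PMF Z} {W₂ : Y → PMF Z} {δ ε : ℝ} (hP : P.IsSecure W₁ W₂ δ ε) {D : ℕ} (hD : 0 < D)
    (hDε : (1 : ℝ) / D < 1 - δ - ε) :
    Fintype.card S ≤ profileCount ((Fintype.card X + 1) ^ P.numUses) D L := by
  classical
  set n := P.numUses
  set w := (Fintype.card X + 1) ^ n with hw_def
  have hw : 0 < w := by positivity
  have hcard : Nat.card (Fin n → Option X) = w := by simp [hw_def]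
  have hcardP : ∀ k, Nat.card (Profile (Fin n → Option X) (profileGrid w D) k) =
      profileCount w D k := fun k => by
    rw [← hcard]; exact Profile.natCard (Fin n → Option X) D k
  have hK : ∀ k, 0 < profileGrid w D k := fun k =>
    Nat.mul_pos (by positivity) (Nat.mul_pos hw (profileCount_pos w D k))
  rw [← hcardP L, ← Nat.card_eq_fintype_card]
  refine Nat.card_le_card_of_injective (fun s : S =>
    P.profile (wordCode n) (profileGrid w D) s L 0 [] Finset.univ) fun s s' hss => ?_
  by_contra hne
  set O := P.impersonate (wordCode n) (profileGrid w D) s s'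
  have herr : roundingError (Fintype.card (Fin n → Option X)) (profileGrid w D)
      (fun i => Fintype.card (Profile (Fin n → Option X) (profileGrid w D) i)) L ≤ 1 / D := by
    simp only [← Nat.card_eq_fintype_card, hcardP, hcard]
    exact roundingError_profileGrid_le hw hD L
  -- The comparison holds for each fixed random input of Bob.
  have hkey : ∀ rB : Fin P.tapeB → Bool,
      (Finset.univ.expect fun r => (P.runI W₁ (TypeIAttack.passive X Z M) s' r rB L 0 [] [] []).prob
        {some s'}) ≤
      (Finset.univ.expect fun r => (P.runI W₁ O s r rB L 0 [] [] []).prob {some s'}) + 1 / D := by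
    intro rB
    refine (expect_passive_le_expect_impersonate (viewO := []) (viewO' := [])
      (σ := ⟨0, Finset.univ, [], Finset.univ, []⟩) hK
      (fun j hL hj x y => wordCode_ofFn_injective (uses_le_numUses hL hj)) L 0 (by omega) rfl rfl
      Finset.univ_nonempty Finset.univ_nonempty hss).trans (add_le_add_right herr _)
  have hhonest : 1 - δ ≤ Finset.univ.expect fun r => (P.honest W₁ s' r).prob {some s'} := by
    refine Finset.le_expect Finset.univ_nonempty fun r _ => ?_
    have h := PMF.one_sub_prob_compl_le (P.honest W₁ s' r) {some s'}
    have h' := hP.correctness s' r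
    have hset : ({some s'}ᶜ : Set (Option S)) = {o | o ≠ some s'} := rfl
    rw [hset] at h
    linarith
  have hattack : (P.attackI W₁ O s).prob {some s'} ≤ ε := by
    refine le_trans (PMF.prob_mono _ ?_) (hP.typeI O s)
    rintro _ rfl
    exact ⟨fun h => hne (Option.some_inj.1 h).symm, by simp⟩
  have h1 : (Finset.univ.expect fun r => (P.honest W₁ s' r).prob {some s'}) ≤
      (P.attackI W₁ O s).prob {some s'} + 1 / D := by
    simp only [honest, attackI, PMF.prob_uniformOfFintype_bind]
    rw [Finset.expect_comm, Finset.expect_comm (f := fun a a' =>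
      (P.runI W₁ O s a a' L 0 [] [] []).prob {some s'}),
      ← Finset.expect_const (Finset.univ_nonempty (α := Fin P.tapeB → Bool)) (1 / (D : ℝ)),
      ← Finset.expect_add_distrib]
    exact Finset.expect_le_expect fun rB _ => hkey rB
  linarith

end AuthProtocol

theorem mainTheorem2 {X Y Z : Type*} [Fintype X] [Fintype Y] [Fintype Z]
    (W₁ : X → PMF Z) (W₂ : Y → PMF Z) (δ ε : ℝ) (hδε : δ + ε < 1) :
    ∃ n₀ : ℕ, ∀ (L n : ℕ) (S M : Type*) [Fintype S] (P : AuthProtocol X Z S M L),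
      P.numUses = n → n₀ ≤ n → P.IsSecure W₁ W₂ δ ε →
        (logStar (Fintype.card S) : ℤ) - (logStar n : ℤ) - 5 ≤ (L : ℤ) := by
  obtain ⟨D, hD⟩ := exists_nat_one_div_lt (show 0 < 1 - δ - ε by linarith)
  -- Here `Fintype.card X + 1` is the number of letters of the codes of words.
  refine ⟨2 * (Fintype.card X + 1) + 2 * (D + 1) + 4, ?_⟩
  rintro L n S M _ P rfl hn hP
  have h1 := AuthProtocol.card_le_profileCount hP D.succ_pos (by push_cast; exact hD)
  have h2 := (logStar_mono (Nat.cast_le.2 h1)).trans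
    (logStar_profileCount_le (Fintype.card X).succ_pos D.succ_pos hn L)
  omega
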